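/- Let $G$ be a finite simple graph with an even number of vertices, drawn in the plane without crossings (vertices are distinct points, edges are simple arcs joining their ends and meeting vertices and other edges only at common ends), and let every edge $e$ carry a weight $\omega_e$ in a commutative ring (for instance a real number). For a weighted graph $H$ let $M(H)$ be the sum, over all perfect matchings of $H$, of the product of the weights of the edges of the matching; the graph without vertices has one perfect matching, of weight $1$. Deleting a vertex removes it together with its incident edges; deleting an edge keeps all vertices; the remaining weights are unchanged. Let $a_1, b_1$ be vertices of $G$ and let $e=a_2b_2$ be an edge of $G$, such that the four vertices $a_1,b_1,a_2,b_2$ are distinct and appear in this cyclic order on the boundary of a face $F$ of $G$; that is, there is a closed topological disc contained in $F$ except for four points of its boundary circle, which are $a_1,b_1,a_2,b_2$ in this cyclic order (clockwise or anticlockwise). Then $$M(G)\,M(G-a_1-b_1-e)=M(G-a_1-b_1)\,M(G-e)+\omega_e\,M(G-a_1-a_2)\,M(G-b_1-b_2)-\omega_e\,M(G-a_1-b_2)\,M(G-a_2-b_1).$$ -/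

import Mathlib

/-- A simple graph on the vertex type `V` with a weight in `R` attached to every edge
(values of `weight` at pairs that are not edges play no role). -/
structure WeightedGraph (V : Type*) (R : Type*) where
  graph : SimpleGraph V
  weight : Sym2 V → R

namespace WeightedGraph

variable {V R : Type*}

/-- The weight of a set of edges: the product of the weights of its members. -/
noncomputable def weightOf [CommRing R] (G : WeightedGraph V R) (E : Set (Sym2 V)) : R :=
  ∏ᶠ e ∈ E, G.weight e

/-- `M(G)`: the sum, over all perfect matchings of `G`, of the products of the weights of
their edges. (For finite `V`, the only case of interest, all sums and products are finite.) -/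
noncomputable def M [CommRing R] (G : WeightedGraph V R) : R :=
  ∑ᶠ P : {P : G.graph.Subgraph // P.IsPerfectMatching}, G.weightOf P.1.edgeSet

/-- `G - A` for a set `A` of vertices: the subgraph induced on the complement of `A`,
with the same weights. -/
def deleteVerts (G : WeightedGraph V R) (A : Set V) : WeightedGraph ↥(Aᶜ) R where
  graph := G.graph.induce Aᶜ
  weight := fun e => G.weight (e.map Subtype.val)

/-- `G - E` for a set `E` of edges: all vertices are kept, the edges in `E` are removed. -/
def deleteEdges (G : WeightedGraph V R) (E : Set (Sym2 V)) : WeightedGraph V R where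
  graph := G.graph.deleteEdges E
  weight := G.weight

end WeightedGraph

/-- A plane drawing of a simple graph; the plane is `ℂ`. Vertices are distinct points, every
edge is a simple arc joining its two ends, and an arc meets the vertices and the other arcs
only in ends. A dart is an edge with a chosen direction; the two directions of an edge give
the same arc, traversed in opposite senses. -/
structure PlaneDrawing {V : Type*} (G : SimpleGraph V) where
  pt : V → ℂ
  pt_injective : Function.Injective pt
  arc : ∀ d : G.Dart, Path (pt d.fst) (pt d.snd)
  arc_symm : ∀ d : G.Dart, arc d.symm = (arc d).symm
  arc_injective : ∀ d : G.Dart, Function.Injective (arc d)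
  eq_end_of_arc_eq_pt : ∀ (d : G.Dart) (t : unitInterval) (v : V),
    arc d t = pt v → v ∈ d.edge
  eq_pt_of_arc_eq_arc : ∀ d d' : G.Dart, d.edge ≠ d'.edge → ∀ t t' : unitInterval,
    arc d t = arc d' t' → ∃ v : V, v ∈ d.edge ∧ v ∈ d'.edge ∧ arc d t = pt v

namespace PlaneDrawing

variable {V : Type*} {G : SimpleGraph V}

/-- The set of all points of the plane that lie on the drawing. -/
def support (D : PlaneDrawing G) : Set ℂ :=
  Set.range D.pt ∪ ⋃ d : G.Dart, Set.range (D.arc d)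

/-- The faces of the drawing: the connected components of its complement in the plane. -/
def IsFace (D : PlaneDrawing G) (F : Set ℂ) : Prop :=
  ∃ x ∈ D.supportᶜ, F = connectedComponentIn D.supportᶜ x

/-- The four vertices `a, b, c, d` appear in this cyclic order (clockwise or anticlockwise) on
the face `F`: there is a closed topological disc that lies in `F` except for four points of its
boundary circle, which are, in cyclic order, the vertices `a, b, c, d`. (Cyclically ordered
points of the circle can be moved to `1, i, -1, -i` by a homeomorphism of the disc.)
In particular the four vertices are distinct and lie on the boundary of `F`. The definition
makes sense also when the boundary of `F` is not a cycle of the graph: for a connected graph it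
says that the closed walk along the boundary of `F` visits the vertices in this cyclic order. -/
def CyclicOrderOnFace (D : PlaneDrawing G) (F : Set ℂ) (a b c d : V) : Prop :=
  ∃ φ : ℂ → ℂ,
    ContinuousOn φ (Metric.closedBall 0 1) ∧
    Set.InjOn φ (Metric.closedBall 0 1) ∧
    φ 1 = D.pt a ∧ φ Complex.I = D.pt b ∧ φ (-1) = D.pt c ∧ φ (-Complex.I) = D.pt d ∧
    ∀ z ∈ Metric.closedBall (0 : ℂ) 1,
      z ∉ ({1, Complex.I, -1, -Complex.I} : Set ℂ) → φ z ∈ F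

end PlaneDrawing

/-! Splitting matchings by whether they use `e` gives `M(G) = M(G-e) + ω_e M(G-a₂-b₂)`, and likewise
for `G-a₁-b₁`. Substituting both reduces the claim to Kuo's condensation for `a, b, c, d = a₁, b₁,
a₂, b₂`: `M(G) M(G-a-b-c-d) + M(G-b-d) M(G-a-c) = M(G-c-d) M(G-a-b) + M(G-b-c) M(G-a-d)`.

Kuo's identity compares pairs of matchings that together miss each of the four vertices once, `a`
being missed by the second. The superposition of such a pair consists of paths and cycles, and the
four vertices are the ends of the paths. Exchanging the two matchings outside the component of `a`
preserves the weight and is an involution. It changes which matching misses `c`, hence the side of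
the identity, as soon as the path from `a` does not end at `c` (`PlaneDrawing.not_sameCycle`).

If it did, another path, disjoint from it, would join `b` to `d`. Both avoid the interior of a disc
in the face with `a, b, c, d` in this order on its boundary, which is impossible by
`exists_mem_inter_of_disc`. That lemma needs no Jordan curve theorem, only winding numbers and an
odd-map argument in the style of Borsuk.

Matchings are encoded as involutions whose fixed points are the missed vertices. Components of a
superposition are then orbits of `σ * τ`. -/

/-! ### Continuous logarithms and their change along paths. -/

open unitInterval in
theorem exists_continuous_log_unitSquare {f : I × I → ℂ} (hf : Continuous f)
    (h0 : ∀ p, f p ≠ 0) : ∃ l : I × I → ℂ, Continuous l ∧ ∀ p, Complex.exp (l p) = f p := by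
  -- The retraction of the plane onto the square: `f ∘ r` is lifted through `Complex.exp` on the
  -- whole plane.
  let r : ℝ × ℝ → I × I :=
    fun p => (Set.projIcc 0 1 zero_le_one p.1, Set.projIcc 0 1 zero_le_one p.2)
  have hr : Continuous r := by
    refine Continuous.prodMk ?_ ?_
    · exact continuous_projIcc.comp continuous_fst
    · exact continuous_projIcc.comp continuous_snd
  obtain ⟨l, ⟨-, hl⟩, -⟩ := Complex.isCoveringMapOn_exp.existsUnique_continuousMap_lifts
    (A := ℝ × ℝ) ⟨fun p => f (r p), hf.comp hr⟩ (a₀ := (0, 0)) (Complex.exp_log (h0 (r (0, 0))))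
    (fun x => h0 (r x))
  refine ⟨fun p => l (p.1, p.2), by fun_prop, fun p => ?_⟩
  have := congrFun hl ((p.1 : ℝ), (p.2 : ℝ))
  simpa [r] using this

open unitInterval in
open Classical in
/-- The change of a continuous logarithm along a path. -/
noncomputable def logChange (γ : I → ℂ) : ℂ :=
  if h : ∃ l : I → ℂ, Continuous l ∧ ∀ t, Complex.exp (l t) = γ t then
    h.choose 1 - h.choose 0 else 0

-- Two continuous logarithms of `γ` are lifts through the covering `Complex.exp`, so they differ by
-- a constant. Hence the choice in `logChange` is immaterial.
open unitInterval in
theorem logChange_eq {γ l : I → ℂ} (hl : Continuous l) (h : ∀ t, Complex.exp (l t) = γ t) :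
    logChange γ = l 1 - l 0 := by
  have hex : ∃ l : I → ℂ, Continuous l ∧ ∀ t, Complex.exp (l t) = γ t := ⟨l, hl, h⟩
  rw [logChange, dif_pos hex]
  obtain ⟨hm, h'⟩ := hex.choose_spec
  set m := hex.choose
  have key : (fun t => m t + (l 0 - m 0)) = l := by
    refine Complex.isCoveringMap_exp.eq_of_comp_eq (by fun_prop) hl ?_ 0 (by ring)
    funext t
    apply Subtype.ext
    have : Complex.exp (l 0 - m 0) = 1 := by
      rw [Complex.exp_sub, h, h', div_self]
      rw [← h]; exact Complex.exp_ne_zero _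
    simp [Complex.exp_add, this, h, h']
  have : m 1 + (l 0 - m 0) = l 1 := congrFun key 1
  linear_combination this

open unitInterval in
theorem exists_continuous_log_path {γ : I → ℂ} (hγ : Continuous γ) (h0 : ∀ t, γ t ≠ 0) :
    ∃ l : I → ℂ, Continuous l ∧ ∀ t, Complex.exp (l t) = γ t := by
  obtain ⟨l, hl, h⟩ := exists_continuous_log_unitSquare (f := fun p => γ p.1)
    (hγ.comp continuous_fst) (fun p => h0 _)
  exact ⟨fun t => l (t, 0), by fun_prop, fun t => h _⟩

open unitInterval in
theorem exp_logChange {γ : I → ℂ} (hγ : Continuous γ) (h0 : ∀ t, γ t ≠ 0) :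
    Complex.exp (logChange γ) = γ 1 / γ 0 := by
  obtain ⟨l, hl, h⟩ := exists_continuous_log_path hγ h0
  rw [logChange_eq hl h, Complex.exp_sub, h, h]

open unitInterval in
theorem logChange_neg {γ : I → ℂ} (hγ : Continuous γ) (h0 : ∀ t, γ t ≠ 0) :
    logChange (fun t => -γ t) = logChange γ := by
  obtain ⟨l, hl, h⟩ := exists_continuous_log_path hγ h0
  rw [logChange_eq hl h, logChange_eq (l := fun t => l t + Real.pi * Complex.I) (by fun_prop)]
  · ring
  · intro t
    simp [Complex.exp_add, h]

open unitInterval in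
theorem logChange_symm {γ : I → ℂ} (hγ : Continuous γ) (h0 : ∀ t, γ t ≠ 0) :
    logChange (fun t => γ (σ t)) = -logChange γ := by
  obtain ⟨l, hl, h⟩ := exists_continuous_log_path hγ h0
  rw [logChange_eq hl h, logChange_eq (l := fun t => l (σ t)) (by fun_prop) (fun t => h _)]
  simp

open unitInterval in
/-- The logarithm of a nonvanishing function on the unit square does not change along the
boundary. -/
theorem logChange_square {f : I → I → ℂ} (hf : Continuous fun p : I × I => f p.1 p.2)
    (h0 : ∀ s t, f s t ≠ 0) :
    logChange (fun s => f s 0) + logChange (fun t => f 1 t)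
      = logChange (fun t => f 0 t) + logChange (fun s => f s 1) := by
  obtain ⟨l, hl, h⟩ := exists_continuous_log_unitSquare hf (fun p => h0 _ _)
  rw [logChange_eq (l := fun s => l (s, 0)) (by fun_prop) (fun t => h _),
    logChange_eq (l := fun s => l (1, s)) (by fun_prop) (fun t => h _),
    logChange_eq (l := fun s => l (0, s)) (by fun_prop) (fun t => h _),
    logChange_eq (l := fun s => l (s, 1)) (by fun_prop) (fun t => h _)]
  ring

/-! ### Paths that must cross outside an embedded disc. -/

open unitInterval in
/-- Borsuk's argument: for an injective map `φ` of the disc, the difference `φ x - φ (i y)` of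
points on two diameters has nonzero winding number along the boundary of the square. -/
theorem logChange_diameters_ne {φ : ℂ → ℂ} (hc : ContinuousOn φ (Metric.closedBall 0 1))
    (hinj : Set.InjOn φ (Metric.closedBall 0 1)) {A B : I → ℂ}
    (hA : ∀ s, A s = φ (2 * (s : ℝ) - 1)) (hB : ∀ t, B t = φ ((2 * (t : ℝ) - 1) * Complex.I)) :
    logChange (fun t => A 0 - B t) + logChange (fun s => A s - B 1)
      ≠ logChange (fun s => A s - B 0) + logChange (fun t => A 1 - B t) := by
  intro heq
  -- The pair moves from `(x, iy)` at `t = 0` to antipodal points at `t = 1`, while `p - q = x - iy`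
  -- stays constant. So `φ p - φ q` never vanishes for `(x, y) ≠ 0`, and at `t = 1` it is odd in
  -- `(x, y)`.
  let p : ℝ → ℝ → ℝ → ℂ := fun x y t => ⟨(1 - t / 2) * x, -(t / 2) * y⟩
  let q : ℝ → ℝ → ℝ → ℂ := fun x y t => ⟨-(t / 2) * x, (1 - t / 2) * y⟩
  have hpc : Continuous fun u : ℝ × ℝ × ℝ => p u.1 u.2.1 u.2.2 := by
    simp only [p, Complex.mk_eq_add_mul_I]; fun_prop
  have hqc : Continuous fun u : ℝ × ℝ × ℝ => q u.1 u.2.1 u.2.2 := by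
    simp only [q, Complex.mk_eq_add_mul_I]; fun_prop
  have hball : ∀ (α x y : ℝ), 0 ≤ α → α ≤ 1 → |x| ≤ 1 → |y| ≤ 1 →
      (⟨(1 - α) * x, -α * y⟩ : ℂ) ∈ Metric.closedBall (0 : ℂ) 1 ∧
      (⟨-α * x, (1 - α) * y⟩ : ℂ) ∈ Metric.closedBall (0 : ℂ) 1 := by
    intro α x y h0 h1 hx hy
    simp only [Metric.mem_closedBall, dist_zero_right]
    constructor
    · refine (Complex.norm_le_abs_re_add_abs_im _).trans ?_
      simp only [abs_mul, abs_neg, abs_of_nonneg h0, abs_of_nonneg (sub_nonneg.2 h1)]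
      nlinarith [abs_nonneg x, abs_nonneg y]
    · refine (Complex.norm_le_abs_re_add_abs_im _).trans ?_
      simp only [abs_mul, abs_neg, abs_of_nonneg h0, abs_of_nonneg (sub_nonneg.2 h1)]
      nlinarith [abs_nonneg x, abs_nonneg y]
  let h : ℝ → ℝ → ℝ → ℂ := fun x y t => φ (p x y t) - φ (q x y t)
  have hcont : ∀ x y : I → ℝ, Continuous x → Continuous y → (∀ s, |x s| ≤ 1) →
      (∀ s, |y s| ≤ 1) → Continuous fun u : I × I => h (x u.1) (y u.1) u.2 := by
    intro x y hx hy hx1 hy1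
    refine Continuous.sub ?_ ?_
    · refine hc.comp_continuous (f := fun u : I × I => p (x u.1) (y u.1) u.2)
        (hpc.comp (by fun_prop : Continuous fun u : I × I => (x u.1, y u.1, (u.2 : ℝ)))) ?_
      intro u
      exact (hball (u.2 / 2) _ _ (by linarith [u.2.2.1]) (by linarith [u.2.2.2])
        (hx1 _) (hy1 _)).1
    · refine hc.comp_continuous (f := fun u : I × I => q (x u.1) (y u.1) u.2)
        (hqc.comp (by fun_prop : Continuous fun u : I × I => (x u.1, y u.1, (u.2 : ℝ)))) ?_
      intro u
      exact (hball (u.2 / 2) _ _ (by linarith [u.2.2.1]) (by linarith [u.2.2.2])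
        (hx1 _) (hy1 _)).2
  have hne : ∀ (x y : ℝ) (t : I), |x| ≤ 1 → |y| ≤ 1 → (x ≠ 0 ∨ y ≠ 0) → h x y t ≠ 0 := by
    intro x y t hx hy hxy h0
    have hb := hball (t / 2) x y (by linarith [t.2.1]) (by linarith [t.2.2]) hx hy
    have := hinj hb.1 hb.2 (sub_eq_zero.1 h0)
    rw [Complex.ext_iff] at this
    simp only at this
    rcases hxy with hxy | hxy
    · exact hxy (by linarith [this.1])
    · exact hxy (by linarith [this.2])
  have hodd : ∀ x y : ℝ, h (-x) (-y) 1 = -h x y 1 := by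
    intro x y
    have h1 : p (-x) (-y) 1 = q x y 1 := by
      apply Complex.ext <;> simp only [p, q] <;> ring
    have h2 : q (-x) (-y) 1 = p x y 1 := by
      apply Complex.ext <;> simp only [p, q] <;> ring
    simp only [h, h1, h2]; ring
  have hI : ∀ s : I, |2 * (s : ℝ) - 1| ≤ 1 := fun s =>
    abs_le.2 ⟨by linarith [s.2.1], by linarith [s.2.2]⟩
  have hone : |(1 : ℝ)| ≤ 1 := by simp
  have hmone : |(-1 : ℝ)| ≤ 1 := by simp
  have hstart : ∀ s t : I, A s - B t = h (2 * s - 1) (2 * t - 1) 0 := by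
    intro s t
    rw [hA, hB]
    simp only [h]
    congr 2 <;> apply Complex.ext <;> simp [p, q]
  have hcb := hcont (fun s => 2 * s - 1) (fun _ => -1) (by fun_prop) (by fun_prop) hI fun _ => hmone
  have hct := hcont (fun s => 2 * s - 1) (fun _ => 1) (by fun_prop) (by fun_prop) hI fun _ => hone
  have hcl := hcont (fun _ => -1) (fun s => 2 * s - 1) (by fun_prop) (by fun_prop) (fun _ => hmone) hI
  have hcr := hcont (fun _ => 1) (fun s => 2 * s - 1) (by fun_prop) (by fun_prop) (fun _ => hone) hI
  have hnb : ∀ s t : I, h (2 * s - 1) (-1) t ≠ 0 := fun s t => hne _ _ _ (hI s) hmone (by simp)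
  have hnt : ∀ s t : I, h (2 * s - 1) 1 t ≠ 0 := fun s t => hne _ _ _ (hI s) hone (by simp)
  have hnl : ∀ s t : I, h (-1) (2 * s - 1) t ≠ 0 := fun s t => hne _ _ _ hmone (hI s) (by simp)
  have hnr : ∀ s t : I, h 1 (2 * s - 1) t ≠ 0 := fun s t => hne _ _ _ hone (hI s) (by simp)
  have sb := logChange_square (f := fun s t => h (2 * s - 1) (-1) t) hcb hnb
  have st := logChange_square (f := fun s t => h (2 * s - 1) 1 t) hct hnt
  have sl := logChange_square (f := fun s t => h (-1) (2 * s - 1) t) hcl hnl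
  have sr := logChange_square (f := fun s t => h 1 (2 * s - 1) t) hcr hnr
  have e0 : 2 * ((0 : I) : ℝ) - 1 = -1 := by simp
  have e1 : 2 * ((1 : I) : ℝ) - 1 = 1 := by norm_num
  simp only [hstart, e0, e1] at heq
  simp only [e0, e1] at sb st sl sr
  simp only [Set.Icc.coe_zero, Set.Icc.coe_one] at sb st sl sr
  have hcomp : ∀ {f : I × I → ℂ}, Continuous f → Continuous fun s => f (s, 1) :=
    fun hf => hf.comp (by fun_prop)
  have ob : logChange (fun s : I => h (2 * s - 1) (-1) 1)
      = -logChange (fun s : I => h (2 * s - 1) 1 1) := by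
    rw [← logChange_symm (γ := fun s : I => h (2 * s - 1) 1 1) (hcomp hct) fun s => hnt s 1,
      ← logChange_neg (γ := fun s : I => h (2 * (σ s : I) - 1) 1 1)
        ((hcomp hct).comp unitInterval.continuous_symm) fun s => hnt _ 1]
    congr 1; funext s
    rw [← hodd]
    congr 1
    simp only [unitInterval.coe_symm_eq]; ring
  have ol : logChange (fun s : I => h (-1) (2 * s - 1) 1)
      = -logChange (fun s : I => h 1 (2 * s - 1) 1) := by
    rw [← logChange_symm (γ := fun s : I => h 1 (2 * s - 1) 1) (hcomp hcr) fun s => hnr s 1,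
      ← logChange_neg (γ := fun s : I => h 1 (2 * (σ s : I) - 1) 1)
        ((hcomp hcr).comp unitInterval.continuous_symm) fun s => hnr _ 1]
    congr 1; funext s
    rw [← hodd]
    congr 1
    simp only [unitInterval.coe_symm_eq]; ring
  -- The homotopy carries the boundary of the square to `t = 1`, where by oddness opposite sides
  -- contribute equally to a circuit. Zero total change thus forces zero change along half the
  -- circuit, from `(-1, -1)` to `(1, 1)`; but the values there are opposite, so the exponential of
  -- this change is `-1`.
  have hzero : logChange (fun s : I => h (2 * s - 1) (-1) 1)
      + logChange (fun s : I => h 1 (2 * s - 1) 1) = 0 := by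
    linear_combination (1 / 2 : ℂ) * (sl + st - sb - sr - heq + ob + ol)
  have hexp := congrArg Complex.exp hzero
  have xb := exp_logChange (hcomp hcb) fun s => hnb s 1
  have xr := exp_logChange (hcomp hcr) fun s => hnr s 1
  simp only [e0, e1] at xb xr
  simp only [Set.Icc.coe_one] at xb xr
  rw [Complex.exp_add, xb, xr, Complex.exp_zero] at hexp
  have n1 : h 1 1 1 ≠ 0 := hne 1 1 1 hone hone (by simp)
  have n2 : h 1 (-1) 1 ≠ 0 := hne 1 (-1) 1 hone hmone (by simp)
  have n3 : h (-1) (-1) 1 = -h 1 1 1 := hodd 1 1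
  rw [n3] at hexp
  field_simp at hexp
  norm_num at hexp

open unitInterval in
/-- Two paths outside an embedded disc which join opposite points of its boundary intersect. -/
theorem exists_mem_inter_of_disc {φ : ℂ → ℂ} (hc : ContinuousOn φ (Metric.closedBall 0 1))
    (hinj : Set.InjOn φ (Metric.closedBall 0 1)) (P : Path (φ 1) (φ (-1)))
    (Q : Path (φ Complex.I) (φ (-Complex.I)))
    (hP : ∀ (s : I) (y : ℝ), |y| ≤ 1 → P s ≠ φ (y * Complex.I))
    (hQ : ∀ (t : I) (x : ℝ), |x| ≤ 1 → Q t ≠ φ x) : ∃ s t, P s = Q t := by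
  by_contra! hPQ
  let A : I → ℂ := fun s => φ (2 * (s : ℝ) - 1)
  let B : I → ℂ := fun t => φ ((2 * (t : ℝ) - 1) * Complex.I)
  have hI : ∀ s : I, |2 * (s : ℝ) - 1| ≤ 1 := fun s =>
    abs_le.2 ⟨by linarith [s.2.1], by linarith [s.2.2]⟩
  have hAc : Continuous A := hc.comp_continuous (by fun_prop) fun s => by
    have : (2 * ((s : ℝ) : ℂ) - 1) = ((2 * s - 1 : ℝ) : ℂ) := by push_cast; rfl
    simpa [this, -Complex.ofReal_sub] using hI s
  have hBc : Continuous B := hc.comp_continuous (by fun_prop) fun s => by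
    have : (2 * ((s : ℝ) : ℂ) - 1) = ((2 * s - 1 : ℝ) : ℂ) := by push_cast; rfl
    simpa [this, -Complex.ofReal_sub] using hI s
  have hPB : ∀ s t, P s - B t ≠ 0 := fun s t h => hP s (2 * t - 1) (hI t) <| by
    rw [sub_eq_zero.1 h]; simp [B]
  have hAQ : ∀ s t, A s - Q t ≠ 0 := fun s t h => hQ t (2 * s - 1) (hI s) <| by
    rw [← sub_eq_zero.1 h]; simp [A]
  have A0 : A 0 = φ (-1) := by simp [A]
  have A1 : A 1 = φ 1 := by simp only [A]; congr 1; norm_num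
  have B0 : B 0 = φ (-Complex.I) := by simp [B]
  have B1 : B 1 = φ Complex.I := by simp only [B]; congr 1; norm_num
  -- The loops `P` followed by `A` and `Q` followed by `B` span a torus made of four squares. The
  -- difference of points does not vanish on three of them, so its logarithm would not change around
  -- the fourth, `A × B`, contrary to `logChange_diameters_ne`.
  have h21 := logChange_square (f := fun s t => P s - B t) (by fun_prop) hPB
  have h12 := logChange_square (f := fun s t => A s - Q t) (by fun_prop) hAQ
  have h22 := logChange_square (f := fun s t => P s - Q t) (by fun_prop)
    fun s t => sub_ne_zero.2 (hPQ s t)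
  refine logChange_diameters_ne hc hinj (A := A) (B := B) (fun _ => rfl) (fun _ => rfl) ?_
  simp only [Path.source, Path.target] at h21 h12 h22
  rw [A0, A1] at h12
  rw [B0, B1] at h21
  rw [A0, A1, B0, B1]
  linear_combination h21 + h12 + h22

/-! ### Separation of vertices on a face. -/

namespace PlaneDrawing

variable {V : Type*} {G : SimpleGraph V}

/-- The part of the drawing spanned by a set of vertices. -/
def supportOn (D : PlaneDrawing G) (S : Set V) : Set ℂ :=
  {z | (∃ v ∈ S, z = D.pt v) ∨ ∃ (d : G.Dart) (t : unitInterval),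
    d.fst ∈ S ∧ d.snd ∈ S ∧ z = D.arc d t}

theorem supportOn_subset_support (D : PlaneDrawing G) (S : Set V) :
    D.supportOn S ⊆ D.support := by
  rintro z (⟨v, -, rfl⟩ | ⟨d, t, -, -, rfl⟩)
  · exact Or.inl ⟨v, rfl⟩
  · exact Or.inr (Set.mem_iUnion.2 ⟨d, t, rfl⟩)

theorem mem_of_pt_mem_supportOn (D : PlaneDrawing G) {S : Set V} {v : V}
    (h : D.pt v ∈ D.supportOn S) : v ∈ S := by
  obtain ⟨u, hu, e⟩ | ⟨d, t, h1, h2, e⟩ := h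
  · rwa [D.pt_injective e]
  · have := D.eq_end_of_arc_eq_pt d t v e.symm
    rcases Sym2.mem_iff.1 (show v ∈ s(d.fst, d.snd) from this) with rfl | rfl <;> assumption

/-- Arcs of distinct edges meet only in a common end, which would belong to both vertex sets; a
common edge would have its ends in both. -/
theorem disjoint_supportOn (D : PlaneDrawing G) {S T : Set V} (h : Disjoint S T) :
    Disjoint (D.supportOn S) (D.supportOn T) := by
  have hmem : ∀ (d : G.Dart) (U : Set V), d.fst ∈ U → d.snd ∈ U → ∀ v ∈ d.edge, v ∈ U := by
    intro d U h1 h2 v hv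
    rcases Sym2.mem_iff.1 (show v ∈ s(d.fst, d.snd) from hv) with rfl | rfl <;> assumption
  rw [Set.disjoint_left] at h ⊢
  intro z hS hT
  rcases hT with ⟨v, hv, rfl⟩ | ⟨d', t', h1', h2', hz⟩
  · exact h (D.mem_of_pt_mem_supportOn hS) hv
  rcases hS with ⟨v, hv, rfl⟩ | ⟨d, t, h1, h2, rfl⟩
  · exact h hv (D.mem_of_pt_mem_supportOn (Or.inr ⟨d', t', h1', h2', hz⟩))
  by_cases hd : d.edge = d'.edge
  · have : d.fst ∈ d.edge := Sym2.mem_iff.2 (Or.inl rfl)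
    exact h h1 (hmem d' T h1' h2' _ (hd ▸ this))
  · obtain ⟨v, hv, hv', -⟩ := D.eq_pt_of_arc_eq_arc d d' hd t t' hz
    exact h (hmem d S h1 h2 v hv) (hmem d' T h1' h2' v hv')

theorem joinedIn_supportOn_of_adj (D : PlaneDrawing G) {S : Set V} {u v : V} (hu : u ∈ S)
    (hv : v ∈ S) (h : u = v ∨ G.Adj u v) : JoinedIn (D.supportOn S) (D.pt u) (D.pt v) := by
  rcases h with rfl | h
  · exact JoinedIn.refl (Or.inl ⟨u, hu, rfl⟩)
  · exact ⟨D.arc ⟨(u, v), h⟩, fun t => Or.inr ⟨_, t, hu, hv, rfl⟩⟩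

/-- If `a, b, c, d` lie in this order on a face, then `a` and `c` cannot be joined in the drawing
of a vertex set disjoint from one in which `b` and `d` are joined. -/
theorem not_joinedIn_supportOn (D : PlaneDrawing G) {F : Set ℂ} (hF : D.IsFace F) {a b c d : V}
    (hcyc : D.CyclicOrderOnFace F a b c d) {S T : Set V} (hST : Disjoint S T)
    (hac : JoinedIn (D.supportOn S) (D.pt a) (D.pt c))
    (hbd : JoinedIn (D.supportOn T) (D.pt b) (D.pt d)) : False := by
  obtain ⟨φ, hc, hinj, ha, hb, hc', hd, hφ⟩ := hcyc
  have hdisj := Set.disjoint_left.1 (D.disjoint_supportOn hST)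
  have hFs : F ⊆ D.supportᶜ := by
    obtain ⟨x, -, rfl⟩ := hF
    exact connectedComponentIn_subset _ _
  rw [← ha, ← hc'] at hac
  rw [← hb, ← hd] at hbd
  obtain ⟨P, hP⟩ := hac
  obtain ⟨Q, hQ⟩ := hbd
  have h1S : φ 1 ∈ D.supportOn S := by simpa using hP 0
  have h2S : φ (-1) ∈ D.supportOn S := by simpa using hP 1
  have h1T : φ Complex.I ∈ D.supportOn T := by simpa using hQ 0
  have h2T : φ (-Complex.I) ∈ D.supportOn T := by simpa using hQ 1
  obtain ⟨s, t, hst⟩ := exists_mem_inter_of_disc hc hinj P Q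
    (by
      intro s y hy h
      have hs := hP s
      rw [h] at hs
      have hball : (y * Complex.I : ℂ) ∈ Metric.closedBall (0 : ℂ) 1 := by simpa using hy
      -- Inner points of the diameter lie in the face, off the drawing; its ends lie on the part
      -- drawn for `T`, which is disjoint from the part containing `P`.
      by_cases hz : (y * Complex.I : ℂ) ∈ ({1, Complex.I, -1, -Complex.I} : Set ℂ)
      · rcases hz with hz | hz | hz | hz
        · simpa using congrArg Complex.re hz
        · exact hdisj (hz ▸ hs) h1T
        · simpa using congrArg Complex.re hz
        · exact hdisj (Set.mem_singleton_iff.1 hz ▸ hs) h2T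
      · exact hFs (hφ _ hball hz) (D.supportOn_subset_support S hs))
    (by
      intro t x hx h
      have ht := hQ t
      rw [h] at ht
      have hball : (x : ℂ) ∈ Metric.closedBall (0 : ℂ) 1 := by simpa using hx
      by_cases hz : (x : ℂ) ∈ ({1, Complex.I, -1, -Complex.I} : Set ℂ)
      · rcases hz with hz | hz | hz | hz
        · exact hdisj h1S (hz ▸ ht)
        · simpa using congrArg Complex.im hz
        · exact hdisj h2S (hz ▸ ht)
        · simpa using congrArg Complex.im hz
      · exact hFs (hφ _ hball hz) (D.supportOn_subset_support T ht))
  exact hdisj (hP s) (hst ▸ hQ t)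

end PlaneDrawing

/-! ### Orbits of a product of two involutions. -/

open Equiv

namespace Equiv.Perm

variable {V : Type*} {σ τ : Perm V} {x : V}

/-- `τ` conjugates `σ * τ` to its inverse. If the orbit of `x` is indexed by exponents, with `x` at
`0`, then `τ` acts as `k ↦ -k` and `σ` as `k ↦ 1 - k`. -/
theorem apply_mul_zpow_of_involutive (hσ : ∀ v, σ (σ v) = v) (hτ : ∀ v, τ (τ v) = v)
    (hx : τ x = x) (k : ℤ) : τ (((σ * τ) ^ k) x) = ((σ * τ) ^ (-k)) x := by
  have hσ' : σ⁻¹ = σ := inv_eq_of_mul_eq_one_left (Perm.ext hσ)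
  have hτ' : τ⁻¹ = τ := inv_eq_of_mul_eq_one_left (Perm.ext hτ)
  have h : SemiconjBy τ (σ * τ) (σ * τ)⁻¹ := by
    rw [SemiconjBy, mul_inv_rev, hσ', hτ', mul_assoc]
  have := congrArg (fun p : Perm V => p x) (h.zpow_right k)
  simpa only [Perm.mul_apply, hx, inv_zpow'] using this

theorem apply_mul_zpow_of_involutive' (hσ : ∀ v, σ (σ v) = v) (hτ : ∀ v, τ (τ v) = v)
    (hx : τ x = x) (k : ℤ) : σ (((σ * τ) ^ k) x) = ((σ * τ) ^ (1 - k)) x := by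
  have h1 : σ (((σ * τ) ^ k) x) = (σ * τ) (τ (((σ * τ) ^ k) x)) := by simp [hτ]
  rw [h1, apply_mul_zpow_of_involutive hσ hτ hx, ← Perm.mul_apply, ← zpow_one_add, sub_eq_add_neg]

theorem SameCycle.apply_right_of_involutive (hσ : ∀ v, σ (σ v) = v) (hτ : ∀ v, τ (τ v) = v)
    (hx : τ x = x) {y : V} (h : SameCycle (σ * τ) x y) :
    SameCycle (σ * τ) x (σ y) ∧ SameCycle (σ * τ) x (τ y) := by
  obtain ⟨k, rfl⟩ := h
  exact ⟨⟨1 - k, (apply_mul_zpow_of_involutive' hσ hτ hx k).symm⟩,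
    ⟨-k, (apply_mul_zpow_of_involutive hσ hτ hx k).symm⟩⟩

theorem zpow_apply_eq_zpow_apply_iff (ρ : Perm V) (x : V) (i j : ℤ) :
    (ρ ^ i) x = (ρ ^ j) x ↔ (Function.minimalPeriod ρ x : ℤ) ∣ i - j := by
  have h := MulAction.zpow_smul_eq_iff_minimalPeriod_dvd (a := ρ) (b := x) (n := i - j)
  rw [Perm.smul_def] at h
  have e : (fun y : V => ρ • y) = ρ := rfl
  rw [e] at h
  rw [← h, sub_eq_neg_add, zpow_add, Perm.mul_apply, zpow_neg, Perm.inv_eq_iff_eq]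

/-- In the orbit of a fixed point of an involution `τ` under `σ * τ`, there is at most one other
fixed point of one of the involutions `σ` and `τ`. -/
theorem SameCycle.eq_of_fixed (hσ : ∀ v, σ (σ v) = v) (hτ : ∀ v, τ (τ v) = v)
    (hx : τ x = x) {y z : V} (hy : SameCycle (σ * τ) x y) (hz : SameCycle (σ * τ) x z)
    (hyx : y ≠ x) (hzx : z ≠ x) (hyf : σ y = y ∨ τ y = y) (hzf : σ z = z ∨ τ z = z) : y = z := by
  set n : ℤ := (Function.minimalPeriod (σ * τ) x : ℤ) with hn
  -- Fixed points solve `2k ≡ 0` or `2k ≡ 1` modulo the period `n`. For `n ∤ k` the multiple of `n`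
  -- is an odd one, so parity of `n` decides which equation is solvable, and two solutions are
  -- congruent modulo `n`.
  have key : ∀ k : ℤ, ((σ * τ) ^ k) x ≠ x →
      (σ (((σ * τ) ^ k) x) = ((σ * τ) ^ k) x ∨ τ (((σ * τ) ^ k) x) = ((σ * τ) ^ k) x) →
      ∃ q, (2 * k = n * (2 * q + 1) ∨ 2 * k - 1 = n * (2 * q + 1)) := by
    intro k hk hf
    rw [apply_mul_zpow_of_involutive hσ hτ hx, apply_mul_zpow_of_involutive' hσ hτ hx,
      zpow_apply_eq_zpow_apply_iff, zpow_apply_eq_zpow_apply_iff] at hf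
    have hk' : ¬ n ∣ k := by
      have := zpow_apply_eq_zpow_apply_iff (σ * τ) x k 0
      rw [zpow_zero, one_apply, sub_zero] at this
      rwa [← this]
    rcases hf with ⟨q, hq⟩ | ⟨q, hq⟩
    · rcases Int.even_or_odd' q with ⟨r, rfl | rfl⟩
      · exfalso
        have : (1 : ℤ) = 2 * (n * r + k) := by linear_combination hq
        omega
      · exact ⟨-r - 1, Or.inr (by linear_combination -hq)⟩
    · rcases Int.even_or_odd' q with ⟨r, rfl | rfl⟩
      · exact absurd ⟨-r, by linarith⟩ hk'
      · exact ⟨-r - 1, Or.inl (by linear_combination -hq)⟩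
  obtain ⟨k, rfl⟩ := hy
  obtain ⟨j, rfl⟩ := hz
  obtain ⟨q, hq⟩ := key k hyx hyf
  obtain ⟨r, hr⟩ := key j hzx hzf
  rw [zpow_apply_eq_zpow_apply_iff]
  have mixed : ∀ k j q r : ℤ, 2 * k = n * (2 * q + 1) → 2 * j - 1 = n * (2 * r + 1) → False := by
    intro k j q r h1 h2
    have : (1 : ℤ) = 2 * (j - k + n * (q - r)) := by linear_combination -h2 + h1
    omega
  rcases hq with hq | hq <;> rcases hr with hr | hr
  · exact ⟨q - r, by linarith⟩
  · exact (mixed _ _ _ _ hq hr).elim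
  · exact (mixed _ _ _ _ hr hq).elim
  · exact ⟨q - r, by linarith⟩

/-- The other end of the path that starts at `x`. For period `n = 2m` it has exponent `m` and is
fixed by `τ`; for `n = 2m + 1` it has exponent `m + 1` and is fixed by `σ`. Period `1` is excluded
by `σ x ≠ x`. -/
theorem exists_sameCycle_fixed [Finite V] (hσ : ∀ v, σ (σ v) = v) (hτ : ∀ v, τ (τ v) = v)
    (hx : τ x = x) (hxσ : σ x ≠ x) :
    ∃ y ≠ x, SameCycle (σ * τ) x y ∧ (σ y = y ∨ τ y = y) := by
  set n : ℕ := Function.minimalPeriod (σ * τ) x with hn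
  have hpos : 0 < n := Function.minimalPeriod_pos_of_mem_periodicPts
    ((σ * τ).injective.mem_periodicPts x)
  have hne : ∀ k : ℤ, ¬ (n : ℤ) ∣ k → ((σ * τ) ^ k) x ≠ x := by
    intro k hk h
    have := zpow_apply_eq_zpow_apply_iff (σ * τ) x k 0
    rw [zpow_zero, one_apply, sub_zero] at this
    exact hk (this.1 h)
  have hn1 : n ≠ 1 := by
    intro h
    have h1 : (σ * τ) x = x := by
      have := Function.minimalPeriod_eq_one_iff_isFixedPt.1 (hn ▸ h)
      exact this
    rw [Perm.mul_apply, hx] at h1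
    exact hxσ h1
  rcases Nat.even_or_odd' n with ⟨m, hm | hm⟩
  · refine ⟨((σ * τ) ^ (m : ℤ)) x, hne _ ?_, ⟨m, rfl⟩, Or.inr ?_⟩
    · intro h
      have := Int.le_of_dvd (by omega) h
      omega
    · rw [apply_mul_zpow_of_involutive hσ hτ hx, zpow_apply_eq_zpow_apply_iff]
      exact ⟨-1, by rw [← hn, hm]; push_cast; ring⟩
  · refine ⟨((σ * τ) ^ (m + 1 : ℤ)) x, hne _ ?_, ⟨m + 1, rfl⟩, Or.inl ?_⟩
    · intro h
      have := Int.le_of_dvd (by omega) h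
      omega
    · rw [apply_mul_zpow_of_involutive' hσ hτ hx, zpow_apply_eq_zpow_apply_iff]
      exact ⟨-1, by rw [← hn, hm]; push_cast; ring⟩

open Classical in
/-- The permutation that agrees with `σ` on `C` and with `τ` elsewhere, for involutions `σ` and
`τ` that preserve `C`. -/
noncomputable def splice (C : Set V) (σ τ : Perm V) : Perm V :=
  if h : Function.Involutive (fun v => if v ∈ C then σ v else τ v) then h.toPerm else 1

open Classical in
theorem splice_apply {C : Set V} (hσ : ∀ v, σ (σ v) = v) (hτ : ∀ v, τ (τ v) = v)
    (hσC : ∀ v ∈ C, σ v ∈ C) (hτC : ∀ v ∈ C, τ v ∈ C) (v : V) :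
    splice C σ τ v = if v ∈ C then σ v else τ v := by
  have h : Function.Involutive (fun v => if v ∈ C then σ v else τ v) := by
    intro v
    by_cases hv : v ∈ C
    · simp [hv, hσC v hv, hσ]
    · have : τ v ∉ C := fun h => hv (hτ v ▸ hτC _ h)
      simp [hv, this, hτ]
  rw [splice, dif_pos h]
  rfl

end Equiv.Perm

/-! ### Components of superposed matchings in the drawing. -/

namespace PlaneDrawing

variable {V : Type*} [Finite V] {G : SimpleGraph V}

-- Each application of `σ * τ` follows at most one edge of either matching, and the orbit of a fixed
-- point of `τ` is stable under both involutions.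
open Equiv.Perm in
theorem joinedIn_supportOn_of_sameCycle (D : PlaneDrawing G) {σ τ : Perm V}
    (hσ : ∀ v, σ (σ v) = v) (hτ : ∀ v, τ (τ v) = v) (hσG : ∀ v, σ v = v ∨ G.Adj v (σ v))
    (hτG : ∀ v, τ v = v ∨ G.Adj v (τ v)) {x y : V} (hx : τ x = x)
    (h : SameCycle (σ * τ) x y) :
    JoinedIn (D.supportOn {v | SameCycle (σ * τ) x v}) (D.pt x) (D.pt y) := by
  obtain ⟨k, -, rfl⟩ := h.exists_pow_eq'
  clear h
  induction k with
  | zero => exact JoinedIn.refl (Or.inl ⟨x, SameCycle.refl _ _, rfl⟩)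
  | succ k ih =>
    set y := ((σ * τ) ^ k) x
    have hy : SameCycle (σ * τ) x y := ⟨k, by simp [y]⟩
    have hy1 := (hy.apply_right_of_involutive hσ hτ hx).2
    have hy2 := (hy1.apply_right_of_involutive hσ hτ hx).1
    rw [pow_succ', Perm.mul_apply, Perm.mul_apply]
    refine (ih.trans (D.joinedIn_supportOn_of_adj hy hy1 ?_)).trans
      (D.joinedIn_supportOn_of_adj hy1 hy2 ?_)
    · exact (hτG y).imp_left Eq.symm
    · exact (hσG _).imp_left Eq.symm

open Equiv.Perm in
/-- In the superposition of two matchings which together miss each of `a, b, c, d` once and no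
other vertex, the component of `a` does not contain `c`. -/
theorem not_sameCycle (D : PlaneDrawing G) {F : Set ℂ} (hF : D.IsFace F) {a b c d : V}
    (hcyc : D.CyclicOrderOnFace F a b c d) (hab : a ≠ b) (hac : a ≠ c) (hbc : b ≠ c)
    {σ τ : Perm V} (hσ : ∀ v, σ (σ v) = v) (hτ : ∀ v, τ (τ v) = v)
    (hσG : ∀ v, σ v = v ∨ G.Adj v (σ v)) (hτG : ∀ v, τ v = v ∨ G.Adj v (τ v))
    (hfix : ∀ v, (σ v = v ∨ τ v = v) ↔ v = a ∨ v = b ∨ v = c ∨ v = d)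
    (hdisj : ∀ v, ¬ (σ v = v ∧ τ v = v)) (ha : τ a = a) : ¬ SameCycle (σ * τ) a c := by
  intro hc
  have hbf := (hfix b).2 (by simp)
  have hba : ¬ SameCycle (σ * τ) a b := fun h =>
    hbc (h.eq_of_fixed hσ hτ ha hc hab.symm hac.symm hbf ((hfix c).2 (by simp)))
  have hinv : τ * σ = (σ * τ)⁻¹ := by
    have hσ' : σ⁻¹ = σ := inv_eq_of_mul_eq_one_left (Perm.ext hσ)
    have hτ' : τ⁻¹ = τ := inv_eq_of_mul_eq_one_left (Perm.ext hτ)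
    rw [mul_inv_rev, hσ', hτ']
  have hd : ∀ y, y ≠ b → SameCycle (σ * τ) b y → (σ y = y ∨ τ y = y) → y = d := by
    intro y hyb hy hyf
    rcases (hfix y).1 hyf with rfl | rfl | rfl | rfl
    · exact (hba hy.symm).elim
    · exact (hyb rfl).elim
    · exact (hba (hc.trans hy.symm)).elim
    · rfl
  have hS : Disjoint {v | SameCycle (σ * τ) a v} {v | SameCycle (σ * τ) b v} :=
    Set.disjoint_left.2 fun v h1 h2 => hba (SameCycle.trans h1 (SameCycle.symm h2))
  refine D.not_joinedIn_supportOn hF hcyc hS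
    (D.joinedIn_supportOn_of_sameCycle hσ hτ hσG hτG ha hc) ?_
  -- The second fixed point in the orbit of `b` can only be `d`. If `b` is missed by `σ`, the roles
  -- of `σ` and `τ` are exchanged; `τ * σ` is the inverse of `σ * τ` and has the same orbits.
  rcases hbf with hb | hb
  · obtain ⟨y, hyb, hy, hyf⟩ := exists_sameCycle_fixed hτ hσ hb fun h => hdisj b ⟨hb, h⟩
    have := D.joinedIn_supportOn_of_sameCycle hτ hσ hτG hσG hb hy
    simp only [hinv, sameCycle_inv] at this hy
    rwa [hd y hyb hy hyf.symm] at this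
  · obtain ⟨y, hyb, hy, hyf⟩ := exists_sameCycle_fixed hσ hτ hb fun h => hdisj b ⟨h, hb⟩
    have := D.joinedIn_supportOn_of_sameCycle hσ hτ hσG hτG hb hy
    rwa [hd y hyb hy hyf] at this

end PlaneDrawing

/-! ### Matchings as involutions and Kuo's condensation. -/

/-- The weight of the pair `u, v` if `u` comes before `v` in the order given by `r`,
and `1` otherwise. -/
def orderedWeight {V R : Type*} [One R] (w : Sym2 V → R) (r : V → ℕ) (u v : V) : R :=
  if r u < r v then w s(u, v) else 1

namespace SimpleGraph

open Classical in
/-- The matchings of `G` that miss exactly the vertices in `A`, as involutions whose fixed points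
are the vertices in `A`. -/
noncomputable def matchingPerms {V : Type*} [Fintype V] (G : SimpleGraph V) (A : Finset V) :
    Finset (Perm V) :=
  Finset.univ.filter fun σ => (∀ v, σ (σ v) = v) ∧ (∀ v, σ v = v ↔ v ∈ A) ∧
    ∀ v, σ v = v ∨ G.Adj v (σ v)

theorem mem_matchingPerms {V : Type*} [Fintype V] {G : SimpleGraph V} {A : Finset V}
    {σ : Perm V} :
    σ ∈ G.matchingPerms A ↔ (∀ v, σ (σ v) = v) ∧ (∀ v, σ v = v ↔ v ∈ A) ∧
      ∀ v, σ v = v ∨ G.Adj v (σ v) := by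
  simp [matchingPerms]

/-- The weighted sum over the matchings of `G` that miss exactly the vertices in `A`. -/
noncomputable def matchingSum {V R : Type*} [Fintype V] [CommRing R] (G : SimpleGraph V)
    (w : Sym2 V → R) (r : V → ℕ) (A : Finset V) : R :=
  ∑ σ ∈ G.matchingPerms A, ∏ v, orderedWeight w r v (σ v)

variable {V R : Type*} [Fintype V] [DecidableEq V] [CommRing R]

theorem even_card_of_mem_matchingPerms {G : SimpleGraph V} {A : Finset V} {σ : Perm V}
    (h : σ ∈ G.matchingPerms A) (hV : Even (Fintype.card V)) : Even A.card := by
  obtain ⟨h1, h2, -⟩ := mem_matchingPerms.1 h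
  have hσ : σ ^ 2 ^ 1 = 1 := by
    ext v
    simp [pow_two, h1]
  have hA : σ.supportᶜ = A := by
    ext v
    simp [h2]
  have := Perm.card_compl_support_modEq (p := 2) hσ
  rw [hA] at this
  rw [Nat.even_iff] at hV ⊢
  rw [Nat.ModEq] at this
  omega

theorem matchingSum_eq_zero (G : SimpleGraph V) (w : Sym2 V → R) (r : V → ℕ) {A : Finset V}
    (hV : Even (Fintype.card V)) (hA : ¬ Even A.card) : G.matchingSum w r A = 0 := by
  rw [matchingSum, Finset.sum_eq_zero]
  exact fun σ hσ => absurd (even_card_of_mem_matchingPerms hσ hV) hA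

theorem matchingSum_deleteEdges (G : SimpleGraph V) (w : Sym2 V → R) {r : V → ℕ}
    (hr : Function.Injective r) {A : Finset V} {a b : V} (hab : G.Adj a b) (ha : a ∉ A)
    (hb : b ∉ A) :
    G.matchingSum w r A = (G.deleteEdges {s(a, b)}).matchingSum w r A
      + w s(a, b) * G.matchingSum w r (insert a (insert b A)) := by
  have hne := hab.ne
  rw [matchingSum, ← Finset.sum_filter_not_add_sum_filter _ (fun σ => σ a = b)]
  congr 1
  · refine Finset.sum_congr ?_ fun _ _ => rfl
    ext σ
    simp only [Finset.mem_filter, mem_matchingPerms, deleteEdges_adj, Set.mem_singleton_iff]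
    constructor
    · rintro ⟨⟨h1, h2, h3⟩, h4⟩
      refine ⟨h1, h2, fun v => (h3 v).imp_right fun h => ⟨h, ?_⟩⟩
      rw [Sym2.eq_iff]
      rintro (⟨rfl, h⟩ | ⟨rfl, h⟩)
      · exact h4 h
      · exact h4 (by rw [← h, h1])
    · rintro ⟨h1, h2, h3⟩
      refine ⟨⟨h1, h2, fun v => (h3 v).imp_right And.left⟩, fun h4 => ?_⟩
      rcases h3 a with h | h
      · exact hne (h.symm.trans h4)
      · exact h.2 (by rw [h4])
  · rw [matchingSum, Finset.mul_sum]
    -- Multiplication by the transposition removes the edge `ab` from a matching that uses it, and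
    -- inserts it into one that misses both ends.
    refine Finset.sum_bij' (fun σ _ => σ * swap a b) (fun σ _ => σ * swap a b) ?_ ?_ ?_ ?_ ?_
    · intro σ hσ
      simp only [Finset.mem_filter, mem_matchingPerms] at hσ ⊢
      obtain ⟨⟨h1, h2, h3⟩, h4⟩ := hσ
      have h5 : σ b = a := by rw [← h4, h1]
      have key : ∀ v, (σ * swap a b) v = if v = a then a else if v = b then b else σ v := by
        intro v
        rw [Perm.mul_apply, swap_apply_def]
        split_ifs <;> simp_all
      simp only [key]
      refine ⟨fun v => ?_, fun v => ?_, fun v => ?_⟩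
      · grind
      · grind
      · grind
    · intro σ hσ
      simp only [Finset.mem_filter, mem_matchingPerms] at hσ ⊢
      obtain ⟨h1, h2, h3⟩ := hσ
      have h4 : σ a = a := (h2 a).2 (by simp)
      have h5 : σ b = b := (h2 b).2 (by simp)
      have key : ∀ v, (σ * swap a b) v = if v = a then b else if v = b then a else σ v := by
        intro v
        rw [Perm.mul_apply, swap_apply_def]
        split_ifs <;> simp_all
      simp only [key]
      have h6 := hab.symm
      refine ⟨⟨fun v => ?_, fun v => ?_, fun v => ?_⟩, by simp⟩
      · grind
      · grind
      · grind
    · intro σ _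
      ext v
      simp
    · intro σ _
      ext v
      simp
    · intro σ hσ
      simp only [Finset.mem_filter, mem_matchingPerms] at hσ
      obtain ⟨⟨h1, h2, h3⟩, h4⟩ := hσ
      have h5 : σ b = a := by rw [← h4, h1]
      have hbm : b ∈ Finset.univ.erase a := by simp [hne.symm]
      rw [← Finset.mul_prod_erase _ _ (Finset.mem_univ a), ← Finset.mul_prod_erase _ _ hbm,
        ← Finset.mul_prod_erase Finset.univ (fun v => orderedWeight w r v ((σ * swap a b) v))
          (Finset.mem_univ a),
        ← Finset.mul_prod_erase _ (fun v => orderedWeight w r v ((σ * swap a b) v)) hbm,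
        ← mul_assoc, ← mul_assoc, ← mul_assoc]
      congr 1
      · rw [Perm.mul_apply, Perm.mul_apply, swap_apply_left, swap_apply_right, h4, h5]
        have : r a ≠ r b := fun h => hne (hr h)
        rcases lt_or_gt_of_ne this with h | h
        · simp [orderedWeight, h, h.not_gt]
        · simp [orderedWeight, h, h.not_gt, Sym2.eq_swap]
      · refine Finset.prod_congr rfl fun v hv => ?_
        simp only [Finset.mem_erase] at hv
        rw [Perm.mul_apply, swap_apply_of_ne_of_ne hv.2.1 hv.1]

/-- The signed sum over all pairs of matchings that together miss each of `a, b, c, d` exactly once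
vanishes, since exchanging the matchings outside the component of `a` reverses signs. -/
theorem sum_matchingSum_mul_matchingSum (G : SimpleGraph V) (w : Sym2 V → R) (r : V → ℕ)
    (D : PlaneDrawing G) {F : Set ℂ} (hF : D.IsFace F) {a b c d : V}
    (hcyc : D.CyclicOrderOnFace F a b c d) (hab : a ≠ b) (hac : a ≠ c) (had : a ≠ d)
    (hbc : b ≠ c) :
    ∑ A ∈ Finset.powerset {b, c, d}, (if c ∈ A then (-1 : R) else 1) *
      (G.matchingSum w r A * G.matchingSum w r ({a, b, c, d} \ A)) = 0 := by
  classical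
  set T : Finset V := {a, b, c, d} with hT
  let W : Perm V → R := fun σ => ∏ v, orderedWeight w r v (σ v)
  let S : Finset (Perm V × Perm V) := (Finset.powerset {b, c, d}).biUnion fun A =>
    G.matchingPerms A ×ˢ G.matchingPerms (T \ A)
  have memS : ∀ p, p ∈ S ↔ ∃ A ⊆ {b, c, d}, p.1 ∈ G.matchingPerms A ∧
      p.2 ∈ G.matchingPerms (T \ A) := by
    intro p
    simp only [S, Finset.mem_biUnion, Finset.mem_powerset, Finset.mem_product]
  obtain ⟨C, memC⟩ : ∃ C : Perm V × Perm V → Set V,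
      ∀ p v, v ∈ C p ↔ Perm.SameCycle (p.1 * p.2) a v := ⟨fun p => {v | _}, fun _ _ => Iff.rfl⟩
  -- The pair is kept on the component of `a` and exchanged elsewhere.
  let Φ : Perm V × Perm V → Perm V × Perm V := fun p =>
    (Perm.splice (C p) p.1 p.2, Perm.splice (C p) p.2 p.1)
  have haT : a ∈ T := by simp [hT]
  have facts : ∀ p ∈ S, (∀ v, (Φ p).1 v = if v ∈ C p then p.1 v else p.2 v) ∧
      (∀ v, (Φ p).2 v = if v ∈ C p then p.2 v else p.1 v) ∧
      (∀ v ∈ C p, p.1 v ∈ C p) ∧ (∀ v ∈ C p, p.2 v ∈ C p) ∧ a ∈ C p ∧ c ∉ C p := by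
    rintro ⟨σ, τ⟩ hp
    obtain ⟨A, hA, hσ, hτ⟩ := (memS _).1 hp
    rw [mem_matchingPerms] at hσ hτ
    obtain ⟨hσ1, hσ2, hσ3⟩ := hσ
    obtain ⟨hτ1, hτ2, hτ3⟩ := hτ
    simp only at hσ1 hσ2 hσ3 hτ1 hτ2 hτ3
    have haA : a ∉ A := fun h => by
      have := hA h
      simp [hab, hac, had] at this
    have hτa : τ a = a := (hτ2 a).2 (by simp [haT, haA])
    have hinv : ∀ v ∈ C (σ, τ), σ v ∈ C (σ, τ) ∧ τ v ∈ C (σ, τ) := fun v hv => by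
      rw [memC] at hv ⊢
      rw [memC]
      exact hv.apply_right_of_involutive hσ1 hτ1 hτa
    refine ⟨Perm.splice_apply hσ1 hτ1 (fun v hv => (hinv v hv).1) (fun v hv => (hinv v hv).2),
      Perm.splice_apply hτ1 hσ1 (fun v hv => (hinv v hv).2) (fun v hv => (hinv v hv).1),
      fun v hv => (hinv v hv).1, fun v hv => (hinv v hv).2, (memC _ _).2 (Perm.SameCycle.refl _ _),
      fun hc => D.not_sameCycle hF hcyc hab hac hbc hσ1 hτ1 hσ3 hτ3 ?_ ?_ hτa
        ((memC _ _).1 hc)⟩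
    · intro v
      rw [hσ2, hτ2, Finset.mem_sdiff]
      have : v ∈ T ↔ v = a ∨ v = b ∨ v = c ∨ v = d := by simp [hT]
      rw [← this]
      constructor
      · rintro (h | h)
        · exact Finset.mem_insert_of_mem (hA h)
        · exact h.1
      · intro h
        by_cases hv : v ∈ A
        · exact Or.inl hv
        · exact Or.inr ⟨h, hv⟩
    · intro v
      rw [hσ2, hτ2, Finset.mem_sdiff]
      exact fun h => h.2.2 h.1
  -- The component of `a` is computed from values inside it, which the exchange leaves alone; this
  -- makes `Φ` an involution.
  have hC : ∀ p ∈ S, C (Φ p) = C p := by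
    intro p hp
    obtain ⟨h1, h2, h3, h4, h5, -⟩ := facts p hp
    have hpow : ∀ k : ℕ, (((Φ p).1 * (Φ p).2) ^ k) a = ((p.1 * p.2) ^ k) a := by
      intro k
      induction k with
      | zero => rfl
      | succ k ih =>
        rw [pow_succ', pow_succ', Perm.mul_apply, Perm.mul_apply, ih]
        have hk : ((p.1 * p.2) ^ k) a ∈ C p := (memC _ _).2 ⟨k, by simp⟩
        rw [Perm.mul_apply, Perm.mul_apply, h2, if_pos hk, h1, if_pos (h4 _ hk)]
    ext v
    rw [memC, memC]
    constructor
    · intro h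
      obtain ⟨k, -, rfl⟩ := Perm.SameCycle.exists_pow_eq' h
      exact ⟨k, by rw [hpow]; simp⟩
    · intro h
      obtain ⟨k, -, rfl⟩ := Perm.SameCycle.exists_pow_eq' h
      exact ⟨k, by rw [← hpow]; simp⟩
  have hΦS : ∀ p ∈ S, Φ p ∈ S := by
    intro p hp
    obtain ⟨h1, h2, h3, h4, h5, -⟩ := facts p hp
    obtain ⟨A, hA, hσ, hτ⟩ := (memS _).1 hp
    rw [mem_matchingPerms] at hσ hτ
    obtain ⟨hσ1, hσ2, hσ3⟩ := hσ
    obtain ⟨hτ1, hτ2, hτ3⟩ := hτ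
    have h3' : ∀ v ∉ C p, p.1 v ∉ C p := fun v hv h => hv (hσ1 v ▸ h3 _ h)
    have h4' : ∀ v ∉ C p, p.2 v ∉ C p := fun v hv h => hv (hτ1 v ▸ h4 _ h)
    have hAT : ∀ v ∈ A, v ∈ T := fun v hv => Finset.mem_insert_of_mem (hA hv)
    refine (memS _).2 ⟨Finset.univ.filter fun v => (Φ p).1 v = v, ?_, ?_, ?_⟩
    · intro v hv
      simp only [Finset.mem_filter, Finset.mem_univ, true_and, h1] at hv
      split_ifs at hv with hvC
      · exact hA ((hσ2 v).1 hv)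
      · have := (Finset.mem_sdiff.1 ((hτ2 v).1 hv)).1
        refine (Finset.mem_insert.1 this).resolve_left ?_
        rintro rfl
        exact hvC h5
    · rw [mem_matchingPerms]
      refine ⟨fun v => ?_, fun v => by simp, fun v => ?_⟩
      · by_cases hv : v ∈ C p
        · simp [h1, hv, h3 v hv, hσ1]
        · simp [h1, hv, h4' v hv, hτ1]
      · rw [h1]
        split_ifs
        exacts [hσ3 v, hτ3 v]
    · rw [mem_matchingPerms]
      refine ⟨fun v => ?_, fun v => ?_, fun v => ?_⟩
      · by_cases hv : v ∈ C p
        · simp [h2, hv, h4 v hv, hτ1]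
        · simp [h2, hv, h3' v hv, hσ1]
      · have := hAT v
        simp only [Finset.mem_sdiff, Finset.mem_filter, Finset.mem_univ, true_and, h1, h2]
        split_ifs
        · rw [hτ2, hσ2, Finset.mem_sdiff]
        · rw [hτ2, hσ2, Finset.mem_sdiff]
          exact ⟨fun h => ⟨this h, fun h' => h'.2 h⟩,
            fun h => by_contra fun hn => h.2 ⟨h.1, hn⟩⟩
      · rw [h2]
        split_ifs
        exacts [hτ3 v, hσ3 v]
  have hΦΦ : ∀ p ∈ S, Φ (Φ p) = p := by
    intro p hp
    obtain ⟨h1, h2, -⟩ := facts p hp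
    obtain ⟨h1', h2', -⟩ := facts _ (hΦS p hp)
    rw [hC p hp] at h1' h2'
    refine Prod.ext (Perm.ext fun v => ?_) (Perm.ext fun v => ?_)
    · rw [h1', h1, h2]; split_ifs <;> rfl
    · rw [h2', h1, h2]; split_ifs <;> rfl
  -- Planarity enters here: `c` is outside the component of `a`, so the matching that misses it
  -- changes.
  have hsign : ∀ p ∈ S, ((Φ p).1 c = c ↔ ¬ p.1 c = c) := by
    intro p hp
    obtain ⟨h1, -, -, -, -, h6⟩ := facts p hp
    obtain ⟨A, hA, hσ, hτ⟩ := (memS _).1 hp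
    rw [mem_matchingPerms] at hσ hτ
    rw [h1, if_neg h6, hτ.2.1, hσ.2.1, Finset.mem_sdiff]
    exact and_iff_right (by simp [hT])
  have hW : ∀ p ∈ S, W (Φ p).1 * W (Φ p).2 = W p.1 * W p.2 := by
    intro p hp
    obtain ⟨h1, h2, -⟩ := facts p hp
    simp only [W, ← Finset.prod_mul_distrib, h1, h2]
    refine Finset.prod_congr rfl fun v _ => ?_
    split_ifs
    · rfl
    · exact mul_comm _ _
  have hzero : ∑ p ∈ S, (if p.1 c = c then (-1 : R) else 1) * (W p.1 * W p.2) = 0 := by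
    refine Finset.sum_involution (fun p _ => Φ p) ?_ ?_ hΦS hΦΦ
    · intro p hp
      have := hsign p hp
      rw [hW p hp]
      by_cases h : p.1 c = c <;> simp [this, h]
    · intro p hp _ heq
      have := hsign p hp
      rw [heq] at this
      exact iff_not_self this
  have hexpand : ∑ p ∈ S, (if p.1 c = c then (-1 : R) else 1) * (W p.1 * W p.2)
      = ∑ A ∈ Finset.powerset {b, c, d}, (if c ∈ A then (-1 : R) else 1) *
        (G.matchingSum w r A * G.matchingSum w r (T \ A)) := by
    rw [Finset.sum_biUnion]
    · refine Finset.sum_congr rfl fun A _ => ?_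
      rw [matchingSum, matchingSum, Finset.sum_mul_sum, ← Finset.sum_product', Finset.mul_sum]
      refine Finset.sum_congr rfl fun p hp => ?_
      have := (mem_matchingPerms.1 (Finset.mem_product.1 hp).1).2.1 c
      simp only [this, W]
    · intro A _ A' _ hne
      rw [Function.onFun, Finset.disjoint_left]
      intro p hp hp'
      apply hne
      ext v
      rw [← (mem_matchingPerms.1 (Finset.mem_product.1 hp).1).2.1 v,
        ← (mem_matchingPerms.1 (Finset.mem_product.1 hp').1).2.1 v]
  exact hexpand.symm.trans hzero

/-- Kuo's graphical condensation. -/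
theorem matchingSum_condensation (G : SimpleGraph V) (w : Sym2 V → R) (r : V → ℕ)
    (hV : Even (Fintype.card V)) (D : PlaneDrawing G) {F : Set ℂ} (hF : D.IsFace F) {a b c d : V}
    (hcyc : D.CyclicOrderOnFace F a b c d) (hab : a ≠ b) (hac : a ≠ c) (had : a ≠ d) (hbc : b ≠ c)
    (hbd : b ≠ d) (hcd : c ≠ d) :
    G.matchingSum w r ∅ * G.matchingSum w r {a, b, c, d}
        + G.matchingSum w r {b, d} * G.matchingSum w r {a, c}
      = G.matchingSum w r {c, d} * G.matchingSum w r {a, b}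
        + G.matchingSum w r {b, c} * G.matchingSum w r {a, d} := by
  have hexpand := G.sum_matchingSum_mul_matchingSum w r D hF hcyc hab hac had hbc
  set T : Finset V := {a, b, c, d} with hT
  have hb' : b ∉ ({c, d} : Finset V) := by simp [hbc, hbd]
  have hc' : c ∉ ({d} : Finset V) := by simp [hcd]
  have hs : (Finset.powerset {d} : Finset (Finset V)) = {∅, {d}} := by
    ext s
    simp [Finset.subset_singleton_iff]
  rw [Finset.sum_powerset_insert hb', Finset.sum_powerset_insert hc',
    Finset.sum_powerset_insert hc', hs] at hexpand
  have hne : (∅ : Finset V) ≠ {d} := (Finset.singleton_ne_empty d).symm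
  simp only [Finset.sum_pair hne] at hexpand
  -- As the number of vertices is even, only the four subsets of `{b, c, d}` of even size
  -- contribute; they give the four products.
  have odd1 : ∀ x : V, G.matchingSum w r {x} = 0 := fun x =>
    matchingSum_eq_zero G w r hV (by simp)
  have odd3 : G.matchingSum w r {b, c, d} = 0 := by
    refine matchingSum_eq_zero G w r hV ?_
    rw [Finset.card_insert_of_notMem hb', Finset.card_insert_of_notMem hc',
      Finset.card_singleton]
    decide
  have e1 : T \ {b, d} = {a, c} := by
    ext x
    simp only [hT, Finset.mem_sdiff, Finset.mem_insert, Finset.mem_singleton]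
    grind
  have e2 : T \ {c, d} = {a, b} := by
    ext x
    simp only [hT, Finset.mem_sdiff, Finset.mem_insert, Finset.mem_singleton]
    grind
  have e3 : T \ {b, c} = {a, d} := by
    ext x
    simp only [hT, Finset.mem_sdiff, Finset.mem_insert, Finset.mem_singleton]
    grind
  simp [odd1, odd3, e1, e2, e3, hbc.symm, hcd] at hexpand
  linear_combination hexpand

end SimpleGraph

/-! ### Translation from perfect matchings as subgraphs. -/

namespace SimpleGraph

/-- The perfect matching given by an involution that moves every vertex to a neighbour. -/
def subgraphOfPerm {V : Type*} (G : SimpleGraph V) (σ : Perm V) (hσ : ∀ v, σ (σ v) = v)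
    (hG : ∀ v, G.Adj v (σ v)) : G.Subgraph where
  verts := Set.univ
  Adj u v := σ u = v
  adj_sub := by rintro u v rfl; exact hG u
  edge_vert := fun _ => trivial
  symm := ⟨by rintro u v rfl; exact hσ u⟩

theorem mem_matchingPerms_empty {V : Type*} [Fintype V] {G : SimpleGraph V} {σ : Perm V} :
    σ ∈ G.matchingPerms ∅ ↔ (∀ v, σ (σ v) = v) ∧ ∀ v, G.Adj v (σ v) := by
  rw [mem_matchingPerms]
  constructor
  · rintro ⟨h1, h2, h3⟩
    exact ⟨h1, fun v => (h3 v).resolve_left fun h => by simpa using (h2 v).1 h⟩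
  · rintro ⟨h1, h2⟩
    exact ⟨h1, fun v => by simpa using (h2 v).ne', fun v => Or.inr (h2 v)⟩

/-- Every edge is counted only at its end of smaller rank, so the product over vertices has each
edge weight once. -/
theorem finprod_edgeSet_subgraphOfPerm {V R : Type*} [Fintype V] [CommRing R]
    (G : SimpleGraph V) (w : Sym2 V → R) {r : V → ℕ} (hr : Function.Injective r) (σ : Perm V)
    (hσ : ∀ v, σ (σ v) = v) (hG : ∀ v, G.Adj v (σ v)) :
    ∏ᶠ e ∈ (G.subgraphOfPerm σ hσ hG).edgeSet, w e = ∏ v, orderedWeight w r v (σ v) := by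
  classical
  have hedge : (G.subgraphOfPerm σ hσ hG).edgeSet
      = (fun v => s(v, σ v)) '' {v | r v < r (σ v)} := by
    ext e
    induction e using Sym2.ind with | _ x y =>
    simp only [Subgraph.mem_edgeSet, Set.mem_image, Set.mem_ofPred_eq]
    constructor
    · intro h
      replace h : σ x = y := h
      subst h
      have : r x ≠ r (σ x) := fun h => (hG x).ne (hr h)
      rcases lt_or_gt_of_ne this with h | h
      · exact ⟨x, h, rfl⟩
      · exact ⟨σ x, by rwa [hσ], by rw [hσ, Sym2.eq_swap]⟩
    · rintro ⟨v, -, h⟩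
      rcases Sym2.eq_iff.1 h with ⟨rfl, rfl⟩ | ⟨rfl, rfl⟩
      · rfl
      · exact hσ v
  have hinj : Set.InjOn (fun v => s(v, σ v)) {v | r v < r (σ v)} := by
    intro u hu v hv h
    rcases Sym2.eq_iff.1 h with ⟨h, -⟩ | ⟨h1, h2⟩
    · exact h
    · simp only [Set.mem_ofPred_eq] at hu hv
      rw [h2, h1] at hu
      exact absurd hu hv.not_gt
  rw [hedge, finprod_mem_image hinj, finprod_mem_def, finprod_eq_prod_of_fintype]
  refine Finset.prod_congr rfl fun v _ => ?_
  rw [Set.mulIndicator_apply]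
  rfl

end SimpleGraph

namespace WeightedGraph

open SimpleGraph

theorem M_eq_matchingSum {V R : Type*} [Fintype V] [CommRing R] (G : WeightedGraph V R)
    {r : V → ℕ} (hr : Function.Injective r) : G.M = G.graph.matchingSum G.weight r ∅ := by
  rw [matchingSum, ← Finset.sum_coe_sort, ← finsum_eq_sum_of_fintype, M]
  symm
  let e : {σ // σ ∈ G.graph.matchingPerms ∅} →
      {P : G.graph.Subgraph // P.IsPerfectMatching} := fun σ =>
    ⟨G.graph.subgraphOfPerm σ.1 (mem_matchingPerms_empty.1 σ.2).1
        (mem_matchingPerms_empty.1 σ.2).2,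
      fun v _ => ⟨σ.1 v, rfl, fun _ h => Eq.symm (show σ.1 v = _ from h)⟩,
      fun _ => trivial⟩
  refine finsum_eq_of_bijective e ⟨?_, ?_⟩ ?_
  · intro σ τ h
    apply Subtype.ext
    ext v
    have : (e τ).1.Adj v (σ.1 v) := h ▸ (rfl : σ.1 v = σ.1 v)
    exact (show τ.1 v = σ.1 v from this).symm
  · rintro ⟨P, hP⟩
    choose f hf hf' using fun v => hP.1 (hP.2 v)
    have hinv : Function.Involutive f := fun v => (hf' _ _ (hf v).symm).symm
    refine ⟨⟨hinv.toPerm, mem_matchingPerms_empty.2 ⟨hinv, fun v => (hf v).adj_sub⟩⟩, ?_⟩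
    apply Subtype.ext
    refine Subgraph.ext ?_ ?_
    · exact (Set.eq_univ_of_forall hP.2).symm
    · funext u v
      refine propext ⟨?_, fun h => (hf' u v h).symm⟩
      rintro rfl
      exact hf u
  · intro σ
    exact (finprod_edgeSet_subgraphOfPerm G.graph G.weight hr σ.1
      (mem_matchingPerms_empty.1 σ.2).1 (mem_matchingPerms_empty.1 σ.2).2).symm

/-- Involutions of the complement of `A` are extended by the identity on `A`, where the factors are
`1`. All deleted graphs are thus handled on one vertex type. -/
theorem M_deleteVerts_eq_matchingSum {V R : Type*} [Fintype V] [CommRing R]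
    (G : WeightedGraph V R) {r : V → ℕ} (hr : Function.Injective r) (A : Finset V) :
    (G.deleteVerts (A : Set V)).M = G.graph.matchingSum G.weight r A := by
  classical
  rw [M_eq_matchingSum _ (hr.comp Subtype.val_injective), matchingSum, matchingSum]
  have hA : ∀ v, v ∈ ((A : Set V)ᶜ : Set V) ↔ v ∉ A := fun v => by simp
  have hmem : ∀ σ ∈ G.graph.matchingPerms A, ∀ v, σ v ∈ ((A : Set V)ᶜ : Set V) ↔
      v ∈ ((A : Set V)ᶜ : Set V) := by
    intro σ hσ v
    obtain ⟨h1, h2, -⟩ := mem_matchingPerms.1 hσ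
    rw [hA, hA, ← h2, ← h2, h1]
    exact not_congr eq_comm
  refine Finset.sum_bij' (fun σ _ => Perm.ofSubtype σ) (fun σ hσ => σ.subtypePerm (hmem σ hσ))
    ?_ ?_ ?_ ?_ ?_
  · intro σ hσ
    obtain ⟨h1, h2⟩ := mem_matchingPerms_empty.1 hσ
    have hin : ∀ v (hv : v ∈ ((A : Set V)ᶜ : Set V)), Perm.ofSubtype σ v = σ ⟨v, hv⟩ :=
      fun v hv => Perm.ofSubtype_apply_of_mem _ hv
    have hout : ∀ v, v ∉ ((A : Set V)ᶜ : Set V) → Perm.ofSubtype σ v = v :=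
      fun v hv => Perm.ofSubtype_apply_of_not_mem _ hv
    rw [mem_matchingPerms]
    refine ⟨fun v => ?_, fun v => ?_, fun v => ?_⟩
    · by_cases hv : v ∈ ((A : Set V)ᶜ : Set V)
      · rw [hin v hv, hin _ (σ ⟨v, hv⟩).2, Subtype.coe_eta, h1]
      · rw [hout v hv, hout v hv]
    · by_cases hv : v ∈ ((A : Set V)ᶜ : Set V)
      · rw [hin v hv]
        exact iff_of_false (fun h => (h2 ⟨v, hv⟩).ne (Subtype.ext h.symm)) ((hA v).1 hv)
      · exact iff_of_true (hout v hv) (by simpa using hv)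
    · by_cases hv : v ∈ ((A : Set V)ᶜ : Set V)
      · rw [hin v hv]
        exact Or.inr (h2 ⟨v, hv⟩)
      · exact Or.inl (hout v hv)
  · intro σ hσ
    obtain ⟨h1, h2, h3⟩ := mem_matchingPerms.1 hσ
    refine mem_matchingPerms_empty.2 ⟨fun v => Subtype.ext (h1 v), fun v => ?_⟩
    exact (h3 v).resolve_left fun h => (hA v).1 v.2 ((h2 v).1 h)
  · intro σ _
    exact Perm.subtypePerm_ofSubtype σ
  · intro σ hσ
    refine Perm.ofSubtype_subtypePerm _ fun v hv => ?_
    rw [hA, ← (mem_matchingPerms.1 hσ).2.1]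
    exact hv
  · intro σ hσ
    have hout : ∀ v, v ∉ ((A : Set V)ᶜ : Set V) → Perm.ofSubtype σ v = v :=
      fun v hv => Perm.ofSubtype_apply_of_not_mem _ hv
    rw [← Finset.prod_subset (Finset.subset_univ Aᶜ) fun v _ hv => by
      rw [hout v (by simpa using hv), orderedWeight, if_neg (lt_irrefl _)],
      Finset.prod_subtype (p := fun v => v ∈ ((A : Set V)ᶜ : Set V)) Aᶜ (by simp)]
    refine Finset.prod_congr rfl fun v _ => ?_
    rw [Perm.ofSubtype_apply_coe]
    rfl

end WeightedGraph

/-! ### The condensation identity with an edge. -/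

theorem theorem3p6 {V : Type*} [Fintype V] {R : Type*} [CommRing R]
    (G : WeightedGraph V R) (heven : Even (Fintype.card V))
    (D : PlaneDrawing G.graph) (F : Set ℂ) (hF : D.IsFace F)
    (a₁ b₁ a₂ b₂ : V) (he : G.graph.Adj a₂ b₂)
    (hcyc : D.CyclicOrderOnFace F a₁ b₁ a₂ b₂) :
    G.M * ((G.deleteEdges {s(a₂, b₂)}).deleteVerts {a₁, b₁}).M =
      (G.deleteVerts {a₁, b₁}).M * (G.deleteEdges {s(a₂, b₂)}).M
        + G.weight s(a₂, b₂) * (G.deleteVerts {a₁, a₂}).M * (G.deleteVerts {b₁, b₂}).M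
        - G.weight s(a₂, b₂) * (G.deleteVerts {a₁, b₂}).M * (G.deleteVerts {a₂, b₁}).M := by
  classical
  -- The vertices are images of distinct points under the injective `φ`; the remaining pair `a₂, b₂`
  -- is an edge.
  have hne : a₁ ≠ b₁ ∧ a₁ ≠ a₂ ∧ a₁ ≠ b₂ ∧ b₁ ≠ a₂ ∧ b₁ ≠ b₂ := by
    obtain ⟨φ, -, hinj, h1, h2, h3, h4, -⟩ := hcyc
    have key : ∀ {u v : V} {z z' : ℂ}, ‖z‖ ≤ 1 → ‖z'‖ ≤ 1 → φ z = D.pt u → φ z' = D.pt v →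
        z ≠ z' → u ≠ v := by
      rintro u v z z' hz hz' hu hv hne rfl
      exact hne (hinj (by simpa using hz) (by simpa using hz') (hu.trans hv.symm))
    refine ⟨key ?_ ?_ h1 h2 ?_, key ?_ ?_ h1 h3 ?_, key ?_ ?_ h1 h4 ?_, key ?_ ?_ h2 h3 ?_,
      key ?_ ?_ h2 h4 ?_⟩ <;> simp [Complex.ext_iff] <;> norm_num
  obtain ⟨h12, h13, h14, h23, h24⟩ := hne
  obtain ⟨r, hr⟩ : ∃ r : V → ℕ, Function.Injective r :=
    ⟨fun v => Fintype.equivFin V v, fun u v h => (Fintype.equivFin V).injective (Fin.ext h)⟩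
  have hdel : ∀ (H : WeightedGraph V R) (u v : V),
      (H.deleteVerts {u, v}).M = H.graph.matchingSum H.weight r {u, v} := fun H u v => by
    rw [← H.M_deleteVerts_eq_matchingSum hr, Finset.coe_pair]
  rw [hdel, hdel, hdel, hdel, hdel, hdel, G.M_eq_matchingSum hr,
    (G.deleteEdges {s(a₂, b₂)}).M_eq_matchingSum hr]
  have kuo := G.graph.matchingSum_condensation G.weight r heven D hF hcyc h12 h13 h14 h23 h24 he.ne
  have e1 := G.graph.matchingSum_deleteEdges G.weight hr (A := ∅) he (by simp) (by simp)
  have e2 := G.graph.matchingSum_deleteEdges G.weight hr (A := {a₁, b₁}) he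
    (by simp [h13.symm, h23.symm]) (by simp [h14.symm, h24.symm])
  have s1 : (insert a₂ (insert b₂ {a₁, b₁}) : Finset V) = {a₁, b₁, a₂, b₂} := by
    ext x; simp only [Finset.mem_insert, Finset.mem_singleton]; tauto
  have s2 : (insert a₂ (insert b₂ ∅) : Finset V) = {a₂, b₂} := rfl
  have s3 : ({a₂, b₁} : Finset V) = {b₁, a₂} := Finset.pair_comm _ _
  rw [s1] at e2
  rw [s2] at e1
  rw [s3]
  change G.graph.matchingSum G.weight r ∅ *
      (G.graph.deleteEdges {s(a₂, b₂)}).matchingSum G.weight r {a₁, b₁} =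
    G.graph.matchingSum G.weight r {a₁, b₁} *
      (G.graph.deleteEdges {s(a₂, b₂)}).matchingSum G.weight r ∅ + _ - _
  linear_combination (G.graph.matchingSum G.weight r {a₁, b₁}) * e1
    - (G.graph.matchingSum G.weight r ∅) * e2 - G.weight s(a₂, b₂) * kuo
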